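/- Consider the binary channel with complete feedback. A strategy of length $n$ for $M$ messages specifies, for every message $m\in\{1,\dots,M\}$ and every $i\in\{1,\dots,n\}$, the symbol $x_i=x_i(m,y_1,\dots,y_{i-1})\in\{0,1\}$ sent at time $i$, as a function of $m$ and of the symbols $y_1,\dots,y_{i-1}$ received so far. The cloud $B(m)$ is the set of all words $y\in\{0,1\}^n$ that can be received when $m$ is transmitted with at most one error, i.e. the set of those $y$ for which $y_i\neq x_i(m,y_1,\dots,y_{i-1})$ for at most one index $i$. One says that $M$ messages can be transmitted in $n$ channel uses with a single error if there is a strategy for which the clouds $B(1),\dots,B(M)$ are pairwise disjoint. For an integer $n\ge 0$ let $$U(n)=2\left\lfloor\frac{2^n}{2(n+1)}\right\rfloor,\qquad r(n)=2^n-(n+1)U(n),$$ $$M_{\rm ad}(n)=\begin{cases}U(n)&\text{if } r(n)<2n,\\ U(n)+1&\text{if } r(n)\ge 2n.\end{cases}$$ **Theorem.** For every integer $n\ge 0$, $M_{\rm ad}(n)$ messages can be transmitted in $n$ uses of the binary channel with complete feedback and a single error, and this number is optimal: $M$ messages cannot be transmitted for any $M>M_{\rm ad}(n)$. -/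

import Mathlib

/-- A strategy of length `n` for transmitting the messages `0, …, M - 1` over the binary channel
with complete error-free feedback: the symbol sent at time `i` (counted from `0`) is a function of
the message and of the `i` symbols received so far. -/
abbrev FeedbackStrategy (n M : ℕ) : Type :=
  Fin M → (i : Fin n) → (Fin (i : ℕ) → Bool) → Bool

/-- The first `i` symbols of the received word `y`. -/
def receivedPrefix {n : ℕ} (y : Fin n → Bool) (i : Fin n) : Fin (i : ℕ) → Bool :=
  fun j => y (Fin.castLE (Nat.le_of_lt i.isLt) j)

/-- The word the encoder sends for the message `m` when the received word is `y`. -/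
def FeedbackStrategy.sent {n M : ℕ} (S : FeedbackStrategy n M) (m : Fin M) (y : Fin n → Bool) :
    Fin n → Bool :=
  fun i => S m i (receivedPrefix y i)

/-- The cloud of the message `m`: all words that can be received when `m` is transmitted and at
most `t` symbols are received in error. -/
def FeedbackStrategy.cloud {n M : ℕ} (S : FeedbackStrategy n M) (t : ℕ) (m : Fin M) :
    Set (Fin n → Bool) :=
  {y | hammingDist (S.sent m y) y ≤ t}

/-- The strategy corrects `t` errors: the clouds of distinct messages are disjoint. -/
def FeedbackStrategy.Corrects {n M : ℕ} (S : FeedbackStrategy n M) (t : ℕ) : Prop :=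
  ∀ m m' : Fin M, m ≠ m' → Disjoint (S.cloud t m) (S.cloud t m')

/-- `M` messages can be transmitted in `n` uses of the binary channel with complete feedback and at
most `t` errors. -/
def CanTransmit (n t M : ℕ) : Prop :=
  ∃ S : FeedbackStrategy n M, S.Corrects t

/-- `U(n) = 2 ⌊2^n / (2 (n + 1))⌋`; division of natural numbers rounds down. -/
def evenBound (n : ℕ) : ℕ := 2 * (2 ^ n / (2 * (n + 1)))

/-- `r(n) = 2^n - (n + 1) U(n)`, as an integer. -/
def evenBoundRemainder (n : ℕ) : ℤ := 2 ^ n - ((n : ℤ) + 1) * (evenBound n : ℤ)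

/-! Give each message as weight the number of errors it can still absorb plus one; weight 0 means
ruled out. With `n` uses left, weight 2 needs `n + 1` words and weight 1 needs one. Each reception
divides this volume exactly between its two outcomes, so the total is at most `2 ^ n`
(`Resolvable.volume_le`). An odd number of messages meets a further obstruction: the first use
cannot halve it, and the heavier branch must fit into half of the words, which is the condition r(n)
≥ 2n. Conversely, weight-1 messages can even out an odd split of the weight-2 ones, so the volume
bound suffices once there are nearly as many of them (`resolvable_of_volume_le`). One balanced use
produces such a state. -/

/-- The state in which message `m` survives as long as fewer than `w m` further errors occur can be
resolved in `n` uses of the channel. -/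
def Resolvable {M : ℕ} (n : ℕ) (w : Fin M → ℕ) : Prop :=
  ∃ S : FeedbackStrategy n M, ∀ y m m',
    hammingDist (S.sent m y) y < w m → hammingDist (S.sent m' y) y < w m' → m = m'

/-- The state after the symbol `b` has been received, if message `m` asked for `q m` to be sent. -/
def stateAfter {M : ℕ} (w : Fin M → ℕ) (q : Fin M → Bool) (b : Bool) : Fin M → ℕ :=
  fun m => if q m = b then w m else w m - 1

/-- The number of messages that survive exactly `k - 1` further errors. -/
def survivorCount {M : ℕ} (w : Fin M → ℕ) (k : ℕ) : ℕ :=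
  (Finset.univ.filter fun m => w m = k).card

theorem canTransmit_iff_resolvable (n t M : ℕ) :
    CanTransmit n t M ↔ Resolvable n (fun _ : Fin M => t + 1) := by
  unfold CanTransmit Resolvable FeedbackStrategy.Corrects
  refine exists_congr fun S => ⟨fun h y m m' hm hm' => ?_, fun h m m' hne => ?_⟩
  · by_contra hne
    exact Set.disjoint_left.1 (h m m' hne) (Nat.lt_succ_iff.1 hm) (Nat.lt_succ_iff.1 hm')
  · exact Set.disjoint_left.2 fun y hm hm' =>
      hne (h y m m' (Nat.lt_succ_iff.2 hm) (Nat.lt_succ_iff.2 hm'))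

theorem receivedPrefix_cons_succ {n : ℕ} (b : Bool) (y : Fin n → Bool) (i : Fin n) :
    receivedPrefix (Fin.cons b y : Fin (n + 1) → Bool) i.succ =
      (Fin.cons b (receivedPrefix y i) : Fin ((i : ℕ) + 1) → Bool) := by
  funext j
  refine Fin.cases ?_ (fun k => ?_) j
  · rfl
  · rfl

theorem hammingDist_cons {n : ℕ} (x : Fin (n + 1) → Bool) (b : Bool) (y : Fin n → Bool) :
    hammingDist x (Fin.cons b y : Fin (n + 1) → Bool) =
      (if x 0 = b then 0 else 1) + hammingDist (fun i => x i.succ) y := by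
  unfold hammingDist
  rw [Fin.card_filter_univ_succ]
  by_cases h : x 0 = b <;> simp [h, add_comm]

theorem lt_stateAfter_iff {M : ℕ} (w : Fin M → ℕ) (q : Fin M → Bool) (b : Bool) (m : Fin M)
    (d : ℕ) : d < stateAfter w q b m ↔ (if q m = b then 0 else 1) + d < w m := by
  unfold stateAfter
  split_ifs <;> omega

theorem stateAfter_le {M : ℕ} {w : Fin M → ℕ} {k : ℕ} (hw : ∀ m, w m ≤ k) (q : Fin M → Bool)
    (b : Bool) (m : Fin M) : stateAfter w q b m ≤ k := by
  have := hw m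
  unfold stateAfter
  split_ifs <;> omega

theorem resolvable_zero_iff {M : ℕ} (w : Fin M → ℕ) :
    Resolvable 0 w ↔ ∀ m m', 0 < w m → 0 < w m' → m = m' := by
  have hd : ∀ x y : Fin 0 → Bool, hammingDist x y = 0 := fun x y => by
    rw [Subsingleton.elim x y, hammingDist_self]
  simp only [Resolvable, hd]
  exact ⟨fun ⟨_, h⟩ => h default, fun h => ⟨fun _ i => i.elim0, fun _ => h⟩⟩

theorem resolvable_succ_iff {M : ℕ} (n : ℕ) (w : Fin M → ℕ) :
    Resolvable (n + 1) w ↔ ∃ q : Fin M → Bool, ∀ b, Resolvable n (stateAfter w q b) := by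
  constructor
  · rintro ⟨S, hS⟩
    refine ⟨fun m => S m 0 Fin.elim0, fun b =>
      ⟨fun m i p => S m i.succ (Fin.cons b p : Fin ((i : ℕ) + 1) → Bool), fun y m m' h h' => ?_⟩⟩
    rw [lt_stateAfter_iff] at h h'
    have key : ∀ m, hammingDist (S.sent m (Fin.cons b y : Fin (n + 1) → Bool))
        (Fin.cons b y : Fin (n + 1) → Bool) = (if S m 0 Fin.elim0 = b then 0 else 1) +
          hammingDist (FeedbackStrategy.sent (n := n) (M := M)
            (fun m i p => S m i.succ (Fin.cons b p : Fin ((i : ℕ) + 1) → Bool)) m y) y := by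
      intro m
      rw [hammingDist_cons]
      have h0 : S.sent m (Fin.cons b y : Fin (n + 1) → Bool) 0 = S m 0 Fin.elim0 :=
        congrArg (S m 0) (funext fun j => j.elim0)
      rw [h0]
      exact congrArg (fun x => _ + hammingDist x y)
        (funext fun i => congrArg (S m i.succ) (receivedPrefix_cons_succ b y i))
    exact hS (Fin.cons b y : Fin (n + 1) → Bool) m m' (by rw [key]; exact h) (by rw [key]; exact h')
  · rintro ⟨q, hq⟩
    choose S hS using hq
    -- From the second use on, the first received symbol selects which continuation to follow.
    refine ⟨fun m i => Fin.cases (motive := fun i => (Fin (i : ℕ) → Bool) → Bool)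
      (fun _ => q m) (fun j p => S (p (0 : Fin ((j : ℕ) + 1))) m j
        (Fin.tail (n := (j : ℕ)) (α := fun _ => Bool) p)) i, fun y m m' h h' => ?_⟩
    obtain ⟨b, y, rfl⟩ : ∃ b y', y = (Fin.cons b y' : Fin (n + 1) → Bool) :=
      ⟨y 0, Fin.tail y, (Fin.cons_self_tail y).symm⟩
    rw [hammingDist_cons] at h h'
    exact hS b y m m' ((lt_stateAfter_iff w q b m _).2 h) ((lt_stateAfter_iff w q b m' _).2 h')

/-- A message that survives one more error owns `n + 1` of the words of length `n`, and a message
that survives none owns one. -/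
theorem Resolvable.volume_le {M : ℕ} {n : ℕ} {w : Fin M → ℕ} (hw : ∀ m, w m ≤ 2)
    (h : Resolvable n w) :
    survivorCount w 2 * (n + 1) + survivorCount w 1 ≤ 2 ^ n := by
  have hsum : ∀ (n : ℕ) (w : Fin M → ℕ), survivorCount w 2 * (n + 1) + survivorCount w 1 =
      ∑ m, if w m = 2 then n + 1 else if w m = 1 then 1 else 0 := by
    intro n w
    simp only [survivorCount, Finset.card_filter, Finset.sum_mul, ← Finset.sum_add_distrib]
    refine Finset.sum_congr rfl fun m _ => ?_
    split_ifs <;> omega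
  induction n generalizing w with
  | zero =>
    rw [resolvable_zero_iff] at h
    rw [hsum]
    calc _ ≤ ∑ m, if 0 < w m then 1 else 0 := by
          refine Finset.sum_le_sum fun m _ => ?_
          split_ifs <;> omega
      _ = (Finset.univ.filter fun m => 0 < w m).card := (Finset.card_filter _ _).symm
      _ ≤ 1 := Finset.card_le_one.2 fun m hm m' hm' =>
          h m m' (Finset.mem_filter.1 hm).2 (Finset.mem_filter.1 hm').2
  | succ n ih =>
    obtain ⟨q, hq⟩ := (resolvable_succ_iff n w).1 h
    have ht := ih (stateAfter_le hw q true) (hq true)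
    have hf := ih (stateAfter_le hw q false) (hq false)
    -- Message by message: weight 2 splits as `n + 2 = (n + 1) + 1`, weight 1 as `1 = 1 + 0`.
    have hadd : survivorCount w 2 * (n + 1 + 1) + survivorCount w 1 =
        (survivorCount (stateAfter w q true) 2 * (n + 1) +
          survivorCount (stateAfter w q true) 1) +
        (survivorCount (stateAfter w q false) 2 * (n + 1) +
          survivorCount (stateAfter w q false) 1) := by
      rw [hsum, hsum, hsum, ← Finset.sum_add_distrib]
      refine Finset.sum_congr rfl fun m _ => ?_
      have := hw m
      cases hqm : q m <;> interval_cases hwm : w m <;> simp [stateAfter, hqm, hwm, add_comm]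
    rw [hadd, pow_succ]
    omega

/-- An encoder can divide the messages of either kind in any proportion. -/
theorem exists_survivorCount_stateAfter {M : ℕ} (w : Fin M → ℕ) {a b : ℕ}
    (ha : a ≤ survivorCount w 2) (hb : b ≤ survivorCount w 1) (hw : ∀ m, w m ≤ 2) :
    ∃ q : Fin M → Bool,
      survivorCount (stateAfter w q true) 2 = a ∧
      survivorCount (stateAfter w q true) 1 = b + (survivorCount w 2 - a) ∧
      survivorCount (stateAfter w q false) 2 = survivorCount w 2 - a ∧
      survivorCount (stateAfter w q false) 1 = (survivorCount w 1 - b) + a := by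
  obtain ⟨A, hA, rfl⟩ := Finset.exists_subset_card_eq ha
  obtain ⟨B, hB, rfl⟩ := Finset.exists_subset_card_eq hb
  have hA' : ∀ m ∈ A, w m = 2 := fun m hm => (Finset.mem_filter.1 (hA hm)).2
  have hB' : ∀ m ∈ B, w m = 1 := fun m hm => (Finset.mem_filter.1 (hB hm)).2
  have hcA := Finset.card_sdiff_of_subset hA
  have hcB := Finset.card_sdiff_of_subset hB
  refine ⟨fun m => decide (m ∈ A ∪ B), ?_, ?_, ?_, ?_⟩
  · unfold survivorCount
    congr 1
    ext m
    have := hA' m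
    have := hB' m
    have := hw m
    simp only [stateAfter, Finset.mem_filter, Finset.mem_univ, true_and, decide_eq_true_eq,
      Finset.mem_union]
    grind
  · unfold survivorCount
    rw [← hcA, ← Finset.card_union_of_disjoint]
    · congr 1
      ext m
      have := hA' m
      have := hB' m
      have := hw m
      simp only [stateAfter, Finset.mem_filter, Finset.mem_univ, true_and, decide_eq_true_eq,
        Finset.mem_union, Finset.mem_sdiff]
      grind
    · refine Finset.disjoint_left.2 fun m hm hm' => ?_
      have := hB' m hm
      have := (Finset.mem_filter.1 (Finset.mem_sdiff.1 hm').1).2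
      omega
  · unfold survivorCount
    rw [← hcA]
    congr 1
    ext m
    have := hA' m
    have := hB' m
    have := hw m
    simp only [stateAfter, Finset.mem_filter, Finset.mem_univ, true_and, decide_eq_false_iff_not,
      Finset.mem_union, Finset.mem_sdiff]
    grind
  · unfold survivorCount
    rw [← hcB, ← Finset.card_union_of_disjoint]
    · congr 1
      ext m
      have := hA' m
      have := hB' m
      have := hw m
      simp only [stateAfter, Finset.mem_filter, Finset.mem_univ, true_and,
        decide_eq_false_iff_not, Finset.mem_union, Finset.mem_sdiff]
      grind
    · refine Finset.disjoint_left.2 fun m hm hm' => ?_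
      have := hA' m hm'
      have := (Finset.mem_filter.1 (Finset.mem_sdiff.1 hm).1).2
      omega

theorem sq_add_three_mul_le_two_pow {n : ℕ} (hn : 4 ≤ n) : n ^ 2 + 3 * n ≤ 2 ^ (n + 1) := by
  induction n, hn using Nat.le_induction with
  | base => norm_num
  | succ n hn ih =>
    rw [pow_succ 2 (n + 1)]
    nlinarith

/-- With an odd number of intact messages and few others, the larger half of the intact messages
still fits into half of the words. -/
theorem larger_half_volume_le {n c b : ℕ} (hcb : 2 * c ≤ b) (hbn : b < n)
    (hv : (2 * c + 1) * (n + 1 + 1) + b ≤ 2 ^ (n + 1)) : (c + 1) * (n + 1) + c ≤ 2 ^ n := by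
  rcases Nat.lt_or_ge n 4 with hn | hn
  · interval_cases n <;> norm_num at hv ⊢ <;> omega
  · have h := sq_add_three_mul_le_two_pow hn
    rw [pow_succ 2 n] at h
    -- Twice the left side of the goal is `2 * c * (n + 2) + 2 * n + 2`, which is at most `n ^ 2 + 3
    -- * n` when `2 * c ≤ n - 1`.
    have hc : 2 * c + 1 ≤ n := by omega
    nlinarith

/-- If there are not too few messages that survive no further error, the volume bound is sharp. -/
theorem resolvable_of_volume_le {M : ℕ} {n : ℕ} {w : Fin M → ℕ} (hw : ∀ m, w m ≤ 2)
    (hle : survivorCount w 2 ≤ survivorCount w 1 + 1)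
    (hv : survivorCount w 2 * (n + 1) + survivorCount w 1 ≤ 2 ^ n) : Resolvable n w := by
  induction n generalizing w with
  | zero =>
    rw [resolvable_zero_iff]
    intro m m' hm hm'
    have hc : (Finset.univ.filter fun m => 0 < w m).card ≤ 1 := by
      calc _ ≤ ((Finset.univ.filter fun m => w m = 2) ∪
              (Finset.univ.filter fun m => w m = 1)).card := by
            refine Finset.card_le_card fun m hm => ?_
            have := hw m
            simp only [Finset.mem_union, Finset.mem_filter, Finset.mem_univ, true_and] at hm ⊢
            omega
        _ ≤ survivorCount w 2 + survivorCount w 1 := Finset.card_union_le _ _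
        _ ≤ 1 := by simpa using hv
    exact Finset.card_le_one.1 hc m (by simpa using hm) m' (by simpa using hm')
  | succ n ih =>
    -- Let `a` messages of weight 2 and `b` of weight 1 ask for `true`; both branches must keep the
    -- near-balance and the volume bound.
    obtain ⟨a, b, ha, hb, h₁, h₂, h₃, h₄⟩ : ∃ a b, a ≤ survivorCount w 2 ∧
        b ≤ survivorCount w 1 ∧
        a ≤ b + (survivorCount w 2 - a) + 1 ∧
        a * (n + 1) + (b + (survivorCount w 2 - a)) ≤ 2 ^ n ∧
        survivorCount w 2 - a ≤ (survivorCount w 1 - b) + a + 1 ∧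
        (survivorCount w 2 - a) * (n + 1) + ((survivorCount w 1 - b) + a) ≤ 2 ^ n := by
      generalize survivorCount w 2 = s at *
      generalize survivorCount w 1 = t at *
      obtain ⟨c, rfl | rfl⟩ := Nat.even_or_odd' s
      · refine ⟨c, t / 2, by omega, by omega, by omega, ?_, by omega, ?_⟩
        all_goals
          rw [pow_succ] at hv
          rw [show 2 * c - c = c by omega]
          have : 2 * c * (n + 1 + 1) = 2 * (c * (n + 1)) + 2 * c := by ring
          omega
      · have e₁ : 2 * c + 1 - (c + 1) = c := by omega
        rcases Nat.lt_or_ge t n with htn | htn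
        -- Too few weight-1 messages to equalise the volumes: all of them join the smaller half.
        · have hlarge := larger_half_volume_le (by omega) htn hv
          refine ⟨c + 1, 0, by omega, by omega, by omega, ?_, by omega, ?_⟩
          · rw [e₁]
            omega
          · rw [e₁]
            have : (c + 1) * (n + 1) = c * (n + 1) + n + 1 := by ring
            omega
        -- The extra weight-2 message makes its branch heavier by `n`; equal volumes require `2 * b
        -- = t - n`, up to rounding.
        · refine ⟨c + 1, (t - n) / 2, by omega, by omega, by omega, ?_, by omega, ?_⟩
          all_goals
            rw [pow_succ] at hv
            rw [e₁]
            have : (2 * c + 1) * (n + 1 + 1) = 2 * (c * (n + 1)) + 2 * c + n + 2 := by ring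
            have : (c + 1) * (n + 1) = c * (n + 1) + n + 1 := by ring
            omega
    obtain ⟨q, e₁, e₂, e₃, e₄⟩ := exists_survivorCount_stateAfter w ha hb hw
    refine (resolvable_succ_iff n w).2 ⟨q, fun s => ih (stateAfter_le hw q s) ?_ ?_⟩
    · cases s <;> simp only [e₁, e₂, e₃, e₄] <;> assumption
    · cases s <;> simp only [e₁, e₂, e₃, e₄] <;> assumption

theorem survivorCount_const_self (M k : ℕ) : survivorCount (fun _ : Fin M => k) k = M := by
  simp [survivorCount]

theorem survivorCount_const_of_ne (M : ℕ) {k l : ℕ} (h : k ≠ l) :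
    survivorCount (fun _ : Fin M => k) l = 0 := by
  simp [survivorCount, h]

theorem CanTransmit.mul_le_two_pow {n M : ℕ} (h : CanTransmit n 1 M) : M * (n + 1) ≤ 2 ^ n := by
  have := ((canTransmit_iff_resolvable n 1 M).1 h).volume_le fun _ => le_rfl
  rwa [survivorCount_const_self, survivorCount_const_of_ne M (by decide), add_zero] at this

/-- For an odd number of messages the first use of the channel is unavoidably unbalanced. -/
theorem CanTransmit.two_mul_add_one_mul_add_le {n k : ℕ} (h : CanTransmit (n + 1) 1 (2 * k + 1)) :
    (k + 1) * (n + 1) + k ≤ 2 ^ n := by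
  obtain ⟨q, hq⟩ := (resolvable_succ_iff n _).1 ((canTransmit_iff_resolvable _ 1 _).1 h)
  have h₂ : ∀ b, survivorCount (stateAfter (fun _ => 1 + 1) q b) 2 =
      (Finset.univ.filter fun m => q m = b).card := fun b => by
    unfold survivorCount stateAfter
    congr 1
    ext m
    by_cases hm : q m = b <;> simp [hm]
  have h₁ : ∀ b, survivorCount (stateAfter (fun _ => 1 + 1) q b) 1 =
      (Finset.univ.filter fun m => ¬ q m = b).card := fun b => by
    unfold survivorCount stateAfter
    congr 1
    ext m
    by_cases hm : q m = b <;> simp [hm]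
  have hsum : ∀ b, (Finset.univ.filter fun m => q m = b).card +
      (Finset.univ.filter fun m => ¬ q m = b).card = 2 * k + 1 := fun b => by
    rw [Finset.card_filter_add_card_filter_not]
    simp
  have hv : ∀ b, (Finset.univ.filter fun m => q m = b).card * (n + 1) +
      (Finset.univ.filter fun m => ¬ q m = b).card ≤ 2 ^ n := fun b => by
    have := (hq b).volume_le (stateAfter_le (fun _ => le_rfl) q b)
    rwa [h₁, h₂] at this
  obtain ⟨b, hb⟩ : ∃ b, k + 1 ≤ (Finset.univ.filter fun m => q m = b).card := by
    have ht := hsum true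
    rcases Nat.lt_or_ge (Finset.univ.filter fun m => q m = true).card (k + 1) with hlt | hge
    · refine ⟨false, ?_⟩
      simp only [Bool.not_eq_true] at ht
      omega
    · exact ⟨true, hge⟩
  -- If `N` messages ask for `b`, this branch has volume `N * n + 2 * k + 1`, which is least at `N =
  -- k + 1`.
  have := hsum b
  have := hv b
  nlinarith

/-- Splitting the messages into `k` and `l` at the first use leaves near-balanced branches, where
volume is the only constraint; as `l ≤ k`, the bound `hv` on the heavier branch suffices. -/
theorem canTransmit_succ_of_split {n k l : ℕ} (hkl : k ≤ l + 1) (hlk : l ≤ k)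
    (hv : k * (n + 1) + l ≤ 2 ^ n) : CanTransmit (n + 1) 1 (k + l) := by
  rw [canTransmit_iff_resolvable]
  have hw : ∀ m : Fin (k + l), (fun _ => 1 + 1) m ≤ 2 := fun _ => le_rfl
  have hc₂ : survivorCount (fun _ : Fin (k + l) => 1 + 1) 2 = k + l :=
    survivorCount_const_self _ _
  have hc₁ : survivorCount (fun _ : Fin (k + l) => 1 + 1) 1 = 0 :=
    survivorCount_const_of_ne _ (by decide)
  obtain ⟨q, e₁, e₂, e₃, e₄⟩ := exists_survivorCount_stateAfter (a := k) (b := 0)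
    (fun _ : Fin (k + l) => 1 + 1) (by omega) (Nat.zero_le _) hw
  rw [hc₂] at e₂ e₃
  rw [hc₁] at e₄
  refine (resolvable_succ_iff n _).2 ⟨q, fun s => resolvable_of_volume_le (stateAfter_le hw q s)
    ?_ ?_⟩
  · cases s <;> simp only [e₁, e₂, e₃, e₄] <;> omega
  · cases s <;> simp only [e₁, e₂, e₃, e₄, Nat.add_sub_cancel_left, zero_add, Nat.sub_zero]
    · nlinarith
    · exact hv

/-- The maximum number of messages that can be transmitted over the binary channel in `n` uses with
complete feedback and at most one error. -/
theorem theorem3 (n : ℕ) :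
    IsGreatest {M : ℕ | CanTransmit n 1 M}
      (if evenBoundRemainder n < 2 * (n : ℤ) then evenBound n else evenBound n + 1) := by
  rcases n with _ | n
  · have : (if evenBoundRemainder 0 < 2 * ((0 : ℕ) : ℤ) then evenBound 0
        else evenBound 0 + 1) = 1 := by
      norm_num [evenBoundRemainder, evenBound]
    rw [this]
    refine ⟨(canTransmit_iff_resolvable 0 1 1).2 ((resolvable_zero_iff _).2 fun m m' _ _ =>
      Subsingleton.elim m m'), fun M hM => ?_⟩
    simpa using CanTransmit.mul_le_two_pow hM
  · obtain ⟨k, hk⟩ : ∃ k, 2 ^ (n + 1) / (2 * (n + 1 + 1)) = k := ⟨_, rfl⟩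
    have hU : evenBound (n + 1) = 2 * k := by rw [evenBound, hk]
    have hlow : k * (n + 2) ≤ 2 ^ n := by
      have := Nat.div_mul_le_self (2 ^ (n + 1)) (2 * (n + 1 + 1))
      rw [hk, pow_succ] at this
      nlinarith
    have hupp : 2 ^ n < (k + 1) * (n + 2) := by
      have := Nat.lt_mul_div_succ (2 ^ (n + 1)) (show 0 < 2 * (n + 1 + 1) by omega)
      rw [hk, pow_succ] at this
      nlinarith
    -- Halve the inequality and use `k * (n + 2) + n + 1 = (k + 1) * (n + 1) + k`.
    have hrem : evenBoundRemainder (n + 1) < 2 * ((n + 1 : ℕ) : ℤ) ↔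
        2 ^ n < (k + 1) * (n + 1) + k := by
      rw [evenBoundRemainder, hU, pow_succ]
      zify
      constructor <;> intro h <;> nlinarith
    have hM : ∀ M, CanTransmit (n + 1) 1 M → M ≤ 2 * k + 1 := fun M hM => by
      have h := hM.mul_le_two_pow
      rw [pow_succ] at h
      by_contra! hlt
      have : (2 * k + 2) * (n + 1 + 1) ≤ M * (n + 1 + 1) := Nat.mul_le_mul_right _ hlt
      nlinarith
    simp only [hrem, hU]
    split_ifs with hr
    · refine ⟨?_, fun M hM' => ?_⟩
      · rw [two_mul]
        exact canTransmit_succ_of_split (by omega) le_rfl (by nlinarith)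
      · by_contra! hlt
        have : M = 2 * k + 1 := le_antisymm (hM M hM') hlt
        subst this
        exact absurd (CanTransmit.two_mul_add_one_mul_add_le hM') (by omega)
    · refine ⟨?_, fun M hM' => hM M hM'⟩
      have := canTransmit_succ_of_split (n := n) (k := k + 1) (l := k) le_rfl (by omega) (by omega)
      rwa [show k + 1 + k = 2 * k + 1 by ring] at this
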